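/- **Theorem (Optimality of the Fourier transform).** Let $N\ge 1$. One photon is injected into each of $N$ spatial modes; the photon in mode $k$ has internal state $$\rho_k(\epsilon)=(1-\epsilon)\,|\psi\rangle\langle\psi|+\epsilon\,\rho_\perp^{(k)},$$ where $\psi$ is a common unit vector and $\rho_\perp^{(1)},\dots,\rho_\perp^{(N)}$ are fixed density operators supported on pairwise orthogonal subspaces that are all orthogonal to $\psi$ (orthogonal-bad-bit model: a bad photon is perfectly distinguishable from all the others). The photons pass through a linear-optical network with $N\times N$ unitary mode transformation matrix $U$, which acts trivially on the internal states. All output modes except one, the mode $o$, are measured by photon-number-resolving detectors that do not see the internal state; a run is heralded if the observed pattern lies in a chosen set $S$ of patterns, each with $N-1$ photons in total, so that exactly one photon leaves in mode $o$. Write $P_{U,S,\epsilon}(\mathrm{herald})$ for the probability of this event, and let $\epsilon'=\epsilon'(U,S,\epsilon)$ be the probability, conditional on heralding, that the photon in mode $o$ is in an internal state orthogonal to $\psi$, that is, $\epsilon'=1-\langle\psi|\rho'|\psi\rangle$ for its internal state $\rho'$. 1. For every unitary $U$ and every such $S$, $$\epsilon'\ \ge\ \frac{\epsilon}{N}+O(\epsilon^2):$$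 there is a constant $C$, which can be chosen independently of $U$ and $S$, with $\epsilon'\ge \epsilon/N-C\epsilon^2$ for all $\epsilon\in[0,1]$ with $P_{U,S,\epsilon}(\mathrm{herald})>0$. 2. The bound is attained to first order by the Fourier matrix $F_{jk}=N^{-1/2}e^{2\pi i jk/N}$ ($0\le j,k<N$), which is unitary: if $S$ is non-empty and each of its patterns has positive probability at the output of $F$ for $N$ perfectly indistinguishable photons (all in the state $\psi$), then $P_{F,S,\epsilon}(\mathrm{herald})>0$ for $0\le\epsilon<1$, and $\epsilon'=\epsilon/N+O(\epsilon^2)$, i.e. $|\epsilon'-\epsilon/N|\le C\epsilon^2$ on $[0,1)$ for some $C$ independent of $\epsilon$. For every $N\ne 2$ and every output mode $o$ such a pattern exists. Hence the Fourier-transform distillation scheme is asymptotically optimal over all unitaries. -/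

import Mathlib

open scoped Nat

noncomputable section

namespace PhotonDistillation

/-- `N` photons, photon `k` entering spatial mode `k`, in the orthogonal-bad-bit model.
`ι` labels an orthonormal basis of the internal Hilbert space (polarisation, spectrum, ...) that
contains the target state `ψ` and diagonalises the bad components
`ρ_⊥⁽ᵏ⁾ = ∑ᵢ p k i |i⟩⟨i|`.  These are density operators supported on pairwise orthogonal subspaces,
all orthogonal to `ψ`: a bad photon is perfectly distinguishable from every other photon. -/
structure OrthogonalBadBits (N : ℕ) (ι : Type*) where
  /-- the target internal state -/
  ψ : ι
  /-- the spectrum of the bad component of each photon -/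
  p : Fin N → ι → ℝ
  nonneg : ∀ k i, 0 ≤ p k i
  hasSum_one : ∀ k, HasSum (p k) 1
  orthogonal_target : ∀ k, p k ψ = 0
  orthogonal_bad : ∀ k l, k ≠ l → ∀ i, p k i = 0 ∨ p l i = 0

/-- The eigenvalue at `|i⟩` of `ρ_k(ε) = (1 - ε) |ψ⟩⟨ψ| + ε ρ_⊥⁽ᵏ⁾`. -/
def OrthogonalBadBits.weight {N : ℕ} {ι : Type*} (src : OrthogonalBadBits N ι) (ε : ℝ)
    (k : Fin N) (i : ι) : ℝ :=
  open Classical in (1 - ε) * (if i = src.ψ then 1 else 0) + ε * src.p k i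

/-- Bosonic (finite particle number) Fock space over `N` spatial modes with internal states `ι`,
in the Bargmann representation: the constant `1` is the vacuum, multiplication by the variable
`X (j, i)` is the creation operator of mode `(j, i)`, and the monomial with exponent `n` is the
unnormalised number state with occupation numbers `n`, of squared norm `∏ n_m !`. -/
abbrev Fock (N : ℕ) (ι : Type*) := MvPolynomial (Fin N × ι) ℂ

/-- One photon in each spatial mode `k`, with internal state `χ k`. -/
def inputState {N : ℕ} {ι : Type*} (χ : Fin N → ι) : Fock N ι :=
  ∏ k, MvPolynomial.X (k, χ k)

/-- The action of the linear-optical network with mode transformation matrix `U`: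
`a†_{k,i} ↦ ∑ j, U j k a†_{j,i}`; the internal state is untouched. -/
def linearOptics {N : ℕ} {ι : Type*} (U : Matrix (Fin N) (Fin N) ℂ) : Fock N ι →ₐ[ℂ] Fock N ι :=
  MvPolynomial.aeval fun m => ∑ j, MvPolynomial.C (U j m.1) * MvPolynomial.X (j, m.2)

/-- Born probability of the occupation numbers `n` in the state `Φ`. -/
def occupationProb {N : ℕ} {ι : Type*} (Φ : Fock N ι) (n : Fin N × ι →₀ ℕ) : ℝ :=
  ‖MvPolynomial.coeff n Φ‖ ^ 2 * n.prod fun _ c => (c ! : ℝ)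

/-- Born probability that the occupation numbers of `Φ` lie in `E`. -/
def eventProb {N : ℕ} {ι : Type*} (Φ : Fock N ι) (E : Set (Fin N × ι →₀ ℕ)) : ℝ :=
  open Classical in ∑ n ∈ Φ.support with n ∈ E, occupationProb Φ n

/-- Probability of the event `E` at the output of `U` for the mixed input
`ρ_1(ε) ⊗ ⋯ ⊗ ρ_N(ε)`. -/
def outputProb {N : ℕ} {ι : Type*} (src : OrthogonalBadBits N ι)
    (U : Matrix (Fin N) (Fin N) ℂ) (ε : ℝ) (E : Set (Fin N × ι →₀ ℕ)) : ℝ :=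
  ∑' χ : Fin N → ι, (∏ k, src.weight ε k (χ k)) * eventProb (linearOptics U (inputState χ)) E

/-- Photon counts on the measured output modes, i.e. on all modes except the output mode `o`. -/
abbrev Pattern {N : ℕ} (o : Fin N) := {j : Fin N // j ≠ o} → ℕ

/-- A pattern that leaves exactly one of the `N` photons in the unmeasured mode. -/
def Pattern.LeavesOne {N : ℕ} {o : Fin N} (s : Pattern o) : Prop := ∑ j, s j + 1 = N

/-- Number of photons in spatial mode `j`, whatever their internal states. -/
def photonCount {N : ℕ} {ι : Type*} (n : Fin N × ι →₀ ℕ) (j : Fin N) : ℕ :=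
  n.sum fun m c => if m.1 = j then c else 0

/-- The detectors on the measured modes (number resolving, blind to the internal state) show one
of the patterns in `S`. -/
def heraldEvent {N : ℕ} (ι : Type*) {o : Fin N} (S : Set (Pattern o)) :
    Set (Fin N × ι →₀ ℕ) :=
  {n | (fun j : {j : Fin N // j ≠ o} => photonCount n j) ∈ S}

/-- The unmeasured mode `o` holds a photon in an internal state orthogonal to `ψ`. -/
def errorEvent {N : ℕ} {ι : Type*} (ψ : ι) (o : Fin N) : Set (Fin N × ι →₀ ℕ) :=
  {n | ∃ i, i ≠ ψ ∧ n (o, i) ≠ 0}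

/-- Heralding probability `P_U(herald)` at input error `ε`. -/
def heraldProb {N : ℕ} {ι : Type*} (src : OrthogonalBadBits N ι)
    (U : Matrix (Fin N) (Fin N) ℂ) {o : Fin N} (S : Set (Pattern o)) (ε : ℝ) : ℝ :=
  outputProb src U ε (heraldEvent ι S)

/-- Heralding probability `p₀` for fully indistinguishable photons, all in the state `ψ`. -/
def idealHeraldProb {N : ℕ} {ι : Type*} (src : OrthogonalBadBits N ι)
    (U : Matrix (Fin N) (Fin N) ℂ) {o : Fin N} (S : Set (Pattern o)) : ℝ :=
  eventProb (linearOptics U (inputState fun _ => src.ψ)) (heraldEvent ι S)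

/-- The distilled error `ε' = P_U(error | herald)`, i.e. `1 - ⟨ψ|ρ'|ψ⟩` for the internal state `ρ'`
of the heralded photon. -/
def distilledError {N : ℕ} {ι : Type*} (src : OrthogonalBadBits N ι)
    (U : Matrix (Fin N) (Fin N) ℂ) {o : Fin N} (S : Set (Pattern o)) (ε : ℝ) : ℝ :=
  outputProb src U ε (errorEvent src.ψ o ∩ heraldEvent ι S) / heraldProb src U S ε

/-- The `N × N` Fourier matrix. -/
def fourierMatrix (N : ℕ) : Matrix (Fin N) (Fin N) ℂ :=
  Matrix.of fun j k =>
    Complex.exp (2 * Real.pi * Complex.I * ((j : ℕ) : ℂ) * ((k : ℕ) : ℂ) / (N : ℂ)) /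
      (Real.sqrt N : ℂ)

end PhotonDistillation

end

/-!
Let photon `k` be removed from the input and let the other photons produce a pattern of `S` with
the unmeasured mode `o` empty; together with the entry `U o k` this gives the probability
`transferProb U S χ k` that photon `k` alone accounts for mode `o`.  It does not depend on the
internal state of photon `k`.

Fix the internal states `χ`.  Annihilating the photon in mode `o` (a partial derivative in the
Bargmann representation, `pderiv_outputState`) turns heralding probabilities into probabilities
of sums over the input photons that can be the one in `o`:

* if that photon is bad, it is distinguishable from all the others, so nothing interferes and the
  joint probability of error and herald is the sum of `transferProb U S χ k` over the bad photons
  `k` (`eventProb_error_inter_herald`);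
* if it is good, the amplitudes of at most `N` alternatives add up, so by Cauchy-Schwarz the
  probability is at most `N` times the sum of `transferProb U S χ k` over the good photons `k`
  (`eventProb_herald_diff_error_le`).

Since photon `k` is bad with probability `ε`, independently of the others, averaging over `χ`
turns the two sums into `ε * R` and `(1 - ε) * R` with the same `R`, the sum over `k` of
`meanTransferProb`.  Hence the error event has probability `ε * R` and the herald at most
`(ε + N * (1 - ε)) * R ≤ N * R`, which gives `ε / N ≤ ε'` for every unitary, without a quadratic
correction (`div_le_distilledError`).  The internal states range over a possibly infinite basis;
all averages are convergent sums by `hasSum_prod_pi` and a bound on event probabilities that is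
uniform in `χ`.

To first order in `ε` the only loss is the one in Cauchy-Schwarz for ideal photons, so the bound is
attained to first order as soon as the `N` alternatives for the ideal photon in `o` have equal
amplitudes (`exists_abs_distilledError_sub_le`).  For the Fourier matrix a cyclic shift of the input
modes is a phase at the output (`coeff_outputState_fourier_shift`).  If a pattern has positive ideal
probability, this phase must be trivial for it, and the shift then carries any alternative
into any other with the same amplitude (`fourier_amplitude_eq`).

Such a pattern exists for `N ≠ 2`: for `N = 1` it is empty, and for `N ≥ 3` one takes one photon
in `o`, one in `o - 2` and the rest in `o - 1` (`coeff_outputState_fourier_neighbours`).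
-/

open scoped Nat

namespace PhotonDistillation

open MvPolynomial

/-! ### Event probabilities -/

section EventProb

variable {N : ℕ} {ι : Type*}

theorem occupationProb_nonneg (Φ : Fock N ι) (n : Fin N × ι →₀ ℕ) : 0 ≤ occupationProb Φ n :=
  mul_nonneg (by positivity) (Finset.prod_nonneg fun _ _ => by positivity)

theorem prod_factorial_pos (n : Fin N × ι →₀ ℕ) : 0 < n.prod fun _ c => (c ! : ℝ) :=
  Finset.prod_pos fun _ _ => by positivity

theorem occupationProb_pos {Φ : Fock N ι} {n : Fin N × ι →₀ ℕ} (h : coeff n Φ ≠ 0) :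
    0 < occupationProb Φ n :=
  mul_pos (by positivity) (prod_factorial_pos n)

theorem occupationProb_of_notMem_support {Φ : Fock N ι} {n : Fin N × ι →₀ ℕ}
    (h : n ∉ Φ.support) : occupationProb Φ n = 0 := by
  simp [occupationProb, notMem_support_iff.1 h]

open Classical in
theorem eventProb_eq_sum {Φ : Fock N ι} {D : Finset (Fin N × ι →₀ ℕ)} (h : Φ.support ⊆ D)
    (E : Set (Fin N × ι →₀ ℕ)) :
    eventProb Φ E = ∑ n ∈ D, if n ∈ E then occupationProb Φ n else 0 := by
  rw [eventProb, Finset.sum_filter]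
  refine Finset.sum_subset h fun n _ hn => ?_
  simp [occupationProb_of_notMem_support hn]

theorem eventProb_nonneg (Φ : Fock N ι) (E : Set (Fin N × ι →₀ ℕ)) : 0 ≤ eventProb Φ E :=
  Finset.sum_nonneg fun n _ => occupationProb_nonneg Φ n

theorem eventProb_mono {Φ : Fock N ι} {E E' : Set (Fin N × ι →₀ ℕ)}
    (h : ∀ n ∈ Φ.support, n ∈ E → n ∈ E') : eventProb Φ E ≤ eventProb Φ E' := by
  classical
  rw [eventProb, eventProb]
  refine Finset.sum_le_sum_of_subset_of_nonneg ?_ fun n _ _ => occupationProb_nonneg Φ n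
  intro n
  simp only [Finset.mem_filter]
  exact fun hn => ⟨hn.1, h n hn.1 hn.2⟩

theorem eventProb_congr {Φ : Fock N ι} {E E' : Set (Fin N × ι →₀ ℕ)}
    (h : ∀ n ∈ Φ.support, n ∈ E ↔ n ∈ E') : eventProb Φ E = eventProb Φ E' :=
  le_antisymm (eventProb_mono fun n hn => (h n hn).1) (eventProb_mono fun n hn => (h n hn).2)

theorem eventProb_pos_iff {Φ : Fock N ι} {E : Set (Fin N × ι →₀ ℕ)} :
    0 < eventProb Φ E ↔ ∃ n ∈ E, coeff n Φ ≠ 0 := by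
  classical
  constructor
  · intro h
    obtain ⟨n, hn, -⟩ := Finset.exists_ne_zero_of_sum_ne_zero h.ne'
    rw [Finset.mem_filter, mem_support_iff] at hn
    exact ⟨n, hn.2, hn.1⟩
  · rintro ⟨n, hn, h⟩
    refine Finset.sum_pos' (fun n _ => occupationProb_nonneg Φ n) ⟨n, ?_, occupationProb_pos h⟩
    simpa [hn] using h

theorem eventProb_inter_add_diff (Φ : Fock N ι) (E F : Set (Fin N × ι →₀ ℕ)) :
    eventProb Φ (F ∩ E) + eventProb Φ (E \ F) = eventProb Φ E := by
  classical
  simp only [eventProb_eq_sum subset_rfl, ← Finset.sum_add_distrib]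
  refine Finset.sum_congr rfl fun n _ => ?_
  by_cases h1 : n ∈ E <;> by_cases h2 : n ∈ F <;> simp [h1, h2]

/-- Additivity over a finite family of events that are disjoint and cover `E` on the support. -/
theorem eventProb_eq_sum_of_partition {κ : Type*} {Φ : Fock N ι} {E : Set (Fin N × ι →₀ ℕ)}
    (K : Finset κ) (F : κ → Set (Fin N × ι →₀ ℕ))
    (hE : ∀ n ∈ Φ.support, n ∈ E ↔ ∃ k ∈ K, n ∈ F k)
    (hF : ∀ k ∈ K, ∀ l ∈ K, ∀ n, n ∈ F k → n ∈ F l → k = l) :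
    eventProb Φ E = ∑ k ∈ K, eventProb Φ (F k) := by
  classical
  simp only [eventProb_eq_sum subset_rfl]
  rw [Finset.sum_comm]
  refine Finset.sum_congr rfl fun n hn => ?_
  by_cases h : n ∈ E
  · obtain ⟨k, hk, hkn⟩ := (hE n hn).1 h
    rw [if_pos h, Finset.sum_eq_single_of_mem k hk, if_pos hkn]
    exact fun l hl hlk => if_neg fun hln => hlk (hF l hl k hk n hln hkn)
  · rw [if_neg h, Finset.sum_eq_zero]
    exact fun k hk => if_neg fun hkn => h ((hE n hn).2 ⟨k, hk, hkn⟩)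

theorem eventProb_C_mul (c : ℂ) (Φ : Fock N ι) (E : Set (Fin N × ι →₀ ℕ)) :
    eventProb (C c * Φ) E = ‖c‖ ^ 2 * eventProb Φ E := by
  classical
  have h : (C c * Φ).support ⊆ Φ.support := fun n => by
    simp only [mem_support_iff, coeff_C_mul]; exact right_ne_zero_of_mul
  rw [eventProb_eq_sum h, eventProb_eq_sum subset_rfl, Finset.mul_sum]
  refine Finset.sum_congr rfl fun n _ => ?_
  by_cases hn : n ∈ E <;> simp [hn, occupationProb, mul_pow, mul_assoc]

/-- A superposition of `K.card` states has at most `K.card` times the probability of their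
incoherent sum, by the Cauchy-Schwarz inequality. -/
theorem eventProb_sum_le {κ : Type*} (K : Finset κ) (Φ : κ → Fock N ι)
    (E : Set (Fin N × ι →₀ ℕ)) :
    eventProb (∑ k ∈ K, Φ k) E ≤ K.card * ∑ k ∈ K, eventProb (Φ k) E := by
  classical
  set D := K.biUnion fun k => (Φ k).support
  have hk : ∀ k ∈ K, (Φ k).support ⊆ D := fun k hk =>
    Finset.subset_biUnion_of_mem (fun k => (Φ k).support) hk
  rw [eventProb_eq_sum (support_sum (s := K) (f := Φ)),
    Finset.sum_congr rfl fun k h => eventProb_eq_sum (hk k h) E, Finset.sum_comm, Finset.mul_sum]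
  refine Finset.sum_le_sum fun n _ => ?_
  by_cases hn : n ∈ E
  · simp only [hn, if_true, occupationProb, coeff_sum, ← Finset.sum_mul, ← mul_assoc]
    refine mul_le_mul_of_nonneg_right ?_ (prod_factorial_pos n).le
    calc ‖∑ k ∈ K, coeff n (Φ k)‖ ^ 2 ≤ (∑ k ∈ K, ‖coeff n (Φ k)‖) ^ 2 := by
          gcongr; exact norm_sum_le _ _
      _ ≤ _ := sq_sum_le_card_mul_sum_sq
  · simp [hn]

/-- The equality case of `eventProb_sum_le`: all the amplitudes agree. -/
theorem eventProb_sum_of_coeff_eq {κ : Type*} (K : Finset κ) (Φ : κ → Fock N ι)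
    (E : Set (Fin N × ι →₀ ℕ))
    (h : ∀ n ∈ E, ∀ k ∈ K, ∀ l ∈ K, coeff n (Φ k) = coeff n (Φ l)) :
    eventProb (∑ k ∈ K, Φ k) E = K.card * ∑ k ∈ K, eventProb (Φ k) E := by
  classical
  set D := K.biUnion fun k => (Φ k).support
  have hk : ∀ k ∈ K, (Φ k).support ⊆ D := fun k hk =>
    Finset.subset_biUnion_of_mem (fun k => (Φ k).support) hk
  rw [eventProb_eq_sum (support_sum (s := K) (f := Φ)),
    Finset.sum_congr rfl fun k h => eventProb_eq_sum (hk k h) E, Finset.sum_comm, Finset.mul_sum]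
  refine Finset.sum_congr rfl fun n _ => ?_
  by_cases hn : n ∈ E
  · simp only [hn, if_true, occupationProb, coeff_sum, ← Finset.sum_mul, ← mul_assoc]
    congr 1
    rcases K.eq_empty_or_nonempty with rfl | ⟨l, hl⟩
    · simp
    · rw [Finset.sum_congr rfl fun k hk => h n hn k hk l hl,
        Finset.sum_congr rfl fun k hk => congrArg (fun z : ℂ => ‖z‖ ^ 2) (h n hn k hk l hl)]
      simp [mul_pow]
      ring
  · simp [hn]

theorem prod_factorial_add_single (n : Fin N × ι →₀ ℕ) (x : Fin N × ι) :
    ((n + Finsupp.single x 1).prod fun _ c => (c ! : ℝ)) =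
      (n x + 1) * n.prod fun _ c => (c ! : ℝ) := by
  classical
  have h1 : (n + Finsupp.single x 1).support ⊆ insert x n.support := by
    intro y hy
    by_cases hxy : y = x
    · simp [hxy]
    · simpa [hxy, Ne.symm hxy, Finsupp.single_apply] using hy
  have h2 : n.support ⊆ insert x n.support := Finset.subset_insert _ _
  rw [Finsupp.prod_of_support_subset _ h1 _ (by simp),
    Finsupp.prod_of_support_subset _ h2 _ (by simp),
    ← Finset.mul_prod_erase _ _ (Finset.mem_insert_self x n.support),
    ← Finset.mul_prod_erase _ _ (Finset.mem_insert_self x n.support), ← mul_assoc]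
  congr 1
  · simp [Nat.factorial_succ]
  · refine Finset.prod_congr rfl fun y hy => ?_
    simp [(Finset.ne_of_mem_erase hy).symm]

/-- Differentiation is the annihilation operator of the mode `x`: on configurations with one
photon in `x` it removes that photon and preserves probabilities. -/
theorem eventProb_pderiv (Φ : Fock N ι) (x : Fin N × ι) {A : Set (Fin N × ι →₀ ℕ)}
    (hA : ∀ m ∈ A, m x = 0) :
    eventProb (pderiv x Φ) A = eventProb Φ ((fun m => m + Finsupp.single x 1) '' A) := by
  classical
  have hc : ∀ m ∈ A, coeff m (pderiv x Φ) = coeff (m + Finsupp.single x 1) Φ := fun m hm => by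
    rw [coeff_pderiv, hA m hm]; simp
  refine Finset.sum_bij (fun m _ => m + Finsupp.single x 1) ?_ ?_ ?_ ?_
  · intro m hm
    simp only [Finset.mem_filter, mem_support_iff] at hm ⊢
    exact ⟨hc m hm.2 ▸ hm.1, Set.mem_image_of_mem _ hm.2⟩
  · intro m _ m' _ h
    exact add_right_cancel h
  · intro n hn
    simp only [Finset.mem_filter, mem_support_iff] at hn
    obtain ⟨h, m, hm, rfl⟩ := hn
    refine ⟨m, ?_, rfl⟩
    simp only [Finset.mem_filter, mem_support_iff]
    exact ⟨(hc m hm).symm ▸ h, hm⟩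
  · intro m hm
    simp only [Finset.mem_filter] at hm
    rw [occupationProb, occupationProb, hc m hm.2, prod_factorial_add_single, hA m hm.2]
    simp

end EventProb

/-! ### Photon counts and heralding events -/

section PhotonCount

variable {N : ℕ} {ι : Type*}

theorem photonCount_add (m n : Fin N × ι →₀ ℕ) (j : Fin N) :
    photonCount (m + n) j = photonCount m j + photonCount n j := by
  classical
  refine Finsupp.sum_add_index' (fun _ => by simp) fun x a b => ?_
  split_ifs <;> simp

theorem photonCount_single (x : Fin N × ι) (c : ℕ) (j : Fin N) :
    photonCount (Finsupp.single x c) j = if x.1 = j then c else 0 :=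
  Finsupp.sum_single_index (by simp)

theorem photonCount_eq_zero_iff {n : Fin N × ι →₀ ℕ} {j : Fin N} :
    photonCount n j = 0 ↔ ∀ i, n (j, i) = 0 := by
  rw [photonCount, Finsupp.sum, Finset.sum_eq_zero_iff]
  constructor
  · intro h i
    by_contra hi
    exact hi (by simpa using h (j, i) (Finsupp.mem_support_iff.2 hi))
  · rintro h ⟨j', i⟩ -
    split_ifs with hj
    · obtain rfl : j' = j := hj
      exact h i
    · rfl

theorem sum_photonCount (n : Fin N × ι →₀ ℕ) : ∑ j, photonCount n j = n.degree := by
  simp only [photonCount, Finsupp.sum, Finsupp.degree_apply]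
  rw [Finset.sum_comm]
  simp

theorem photonCount_output_eq_one {o : Fin N} {S : Set (Pattern o)}
    (hS : ∀ s ∈ S, s.LeavesOne) {n : Fin N × ι →₀ ℕ} (hn : n.degree = N)
    (h : n ∈ heraldEvent ι S) : photonCount n o = 1 := by
  have h1 := hS _ h
  have h2 := sum_photonCount n
  rw [Fintype.sum_eq_add_sum_subtype_ne _ o, hn] at h2
  simp only [Pattern.LeavesOne] at h1
  omega

/-- The detectors show a pattern of `S` and the unmeasured mode `o` is empty. -/
def vacuumEvent {N : ℕ} (ι : Type*) {o : Fin N} (S : Set (Pattern o)) :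
    Set (Fin N × ι →₀ ℕ) :=
  {m | photonCount m o = 0 ∧ m ∈ heraldEvent ι S}

/-- The detectors show a pattern of `S` and the unmeasured mode `o` holds exactly one photon, in
the internal state `i`. -/
def singlePhotonEvent {N : ℕ} {ι : Type*} {o : Fin N} (S : Set (Pattern o)) (i : ι) :
    Set (Fin N × ι →₀ ℕ) :=
  (fun m => m + Finsupp.single (o, i) 1) '' vacuumEvent ι S

theorem add_single_mem_heraldEvent {o : Fin N} {S : Set (Pattern o)} {m : Fin N × ι →₀ ℕ}
    {i : ι} : m + Finsupp.single (o, i) 1 ∈ heraldEvent ι S ↔ m ∈ heraldEvent ι S := by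
  have : (fun j : {j : Fin N // j ≠ o} => photonCount (m + Finsupp.single (o, i) 1) j) =
      fun j : {j : Fin N // j ≠ o} => photonCount m j := by
    funext j
    rw [photonCount_add, photonCount_single, if_neg j.2.symm, add_zero]
  simp only [heraldEvent, Set.mem_ofPred_eq, this]

theorem mem_singlePhotonEvent_iff {o : Fin N} {S : Set (Pattern o)} {n : Fin N × ι →₀ ℕ}
    {i : ι} :
    n ∈ singlePhotonEvent S i ↔ n ∈ heraldEvent ι S ∧ photonCount n o = 1 ∧ n (o, i) ≠ 0 := by
  constructor
  · rintro ⟨m, ⟨h0, hm⟩, rfl⟩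
    refine ⟨add_single_mem_heraldEvent.2 hm, ?_, by simp⟩
    simp [photonCount_add, photonCount_single, h0]
  · rintro ⟨hn, h1, hi⟩
    have hle : Finsupp.single (o, i) 1 ≤ n := Finsupp.single_le_iff.2 (Nat.one_le_iff_ne_zero.2 hi)
    have hm : n - Finsupp.single (o, i) 1 + Finsupp.single (o, i) 1 = n := tsub_add_cancel_of_le hle
    refine ⟨n - Finsupp.single (o, i) 1, ⟨?_, ?_⟩, hm⟩
    · rw [← hm, photonCount_add, photonCount_single] at h1
      simpa using h1
    · rwa [← hm, add_single_mem_heraldEvent] at hn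

theorem singlePhotonEvent_disjoint {o : Fin N} {S : Set (Pattern o)} {n : Fin N × ι →₀ ℕ}
    {i i' : ι} (h : n ∈ singlePhotonEvent S i) (h' : n ∈ singlePhotonEvent S i') : i = i' := by
  classical
  obtain ⟨m, ⟨h0, -⟩, rfl⟩ := h
  have h1 := (mem_singlePhotonEvent_iff.1 h').2.2
  by_contra hne
  apply h1
  have : (o, i) ≠ (o, i') := fun h => hne (congrArg Prod.snd h)
  simp [photonCount_eq_zero_iff.1 h0, this]

end PhotonCount

/-! ### Photons at the output of a network -/

section OutputState

variable {N : ℕ} {ι : Type*}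

/-- The output state of the network `U` when only the photons `k ∈ A` are injected, photon `k` in
mode `k` with internal state `χ k`. -/
noncomputable def outputState (U : Matrix (Fin N) (Fin N) ℂ) (χ : Fin N → ι)
    (A : Finset (Fin N)) : Fock N ι :=
  ∏ k ∈ A, ∑ j, C (U j k) * X (j, χ k)

theorem linearOptics_inputState (U : Matrix (Fin N) (Fin N) ℂ) (χ : Fin N → ι) :
    linearOptics U (inputState χ) = outputState U χ Finset.univ := by
  simp [linearOptics, inputState, outputState, map_prod]

theorem outputState_isHomogeneous (U : Matrix (Fin N) (Fin N) ℂ) (χ : Fin N → ι)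
    (A : Finset (Fin N)) : (outputState U χ A).IsHomogeneous A.card := by
  have := IsHomogeneous.prod A (fun k => ∑ j, C (U j k) * (X (j, χ k) : Fock N ι)) (fun _ => 1)
    fun k _ => IsHomogeneous.sum _ _ _ fun j _ => isHomogeneous_C_mul_X _ _
  simpa [outputState] using this

theorem degree_of_mem_support_outputState {U : Matrix (Fin N) (Fin N) ℂ} {χ : Fin N → ι}
    {A : Finset (Fin N)} {n : Fin N × ι →₀ ℕ} (hn : n ∈ (outputState U χ A).support) :
    n.degree = A.card := by
  by_contra h
  exact mem_support_iff.1 hn ((outputState_isHomogeneous U χ A).coeff_eq_zero h)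

open Classical in
/-- Removing a photon in the mode `(o, i)` from the output: it is one of the input photons in the
internal state `i`, and the amplitudes of these alternatives add up. -/
theorem pderiv_outputState (U : Matrix (Fin N) (Fin N) ℂ) (χ : Fin N → ι) (A : Finset (Fin N))
    (o : Fin N) (i : ι) :
    pderiv (o, i) (outputState U χ A) =
      ∑ k ∈ A with χ k = i, C (U o k) * outputState U χ (A.erase k) := by
  have hL : ∀ k, pderiv (o, i) (∑ j, C (U j k) * (X (j, χ k) : Fock N ι)) =
      if χ k = i then C (U o k) else 0 := fun k => by
    rw [map_sum, Finset.sum_eq_single o]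
    · by_cases h : χ k = i <;> simp [pderiv_X, h]
    · intro j _ hj
      rw [pderiv_C_mul, pderiv_X_of_ne (fun h => hj (congrArg Prod.fst h)), mul_zero]
    · simp
  rw [Finset.sum_filter]
  induction A using Finset.induction_on with
  | empty => simp [outputState]
  | insert a A ha ih =>
    have h1 : outputState U χ (insert a A) =
        (∑ j, C (U j a) * X (j, χ a)) * outputState U χ A := Finset.prod_insert ha
    rw [h1, Derivation.leibniz, hL, ih, Finset.sum_insert ha, Finset.erase_insert ha, add_comm,
      smul_eq_mul, smul_eq_mul, mul_ite, mul_zero, Finset.mul_sum]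
    congr 1
    · split_ifs
      · rw [mul_comm]
      · rfl
    · refine Finset.sum_congr rfl fun k hk => ?_
      have hka : a ≠ k := fun h => ha (h ▸ hk)
      have h2 : outputState U χ ((insert a A).erase k) =
          (∑ j, C (U j a) * X (j, χ a)) * outputState U χ (A.erase k) := by
        rw [Finset.erase_insert_of_ne hka]
        exact Finset.prod_insert fun h => ha (Finset.mem_of_mem_erase h)
      rw [h2, mul_ite, mul_zero]
      split_ifs
      · rw [mul_left_comm]
      · rfl

theorem exists_of_mem_support_outputState {U : Matrix (Fin N) (Fin N) ℂ} {χ : Fin N → ι}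
    {A : Finset (Fin N)} {n : Fin N × ι →₀ ℕ} (hn : n ∈ (outputState U χ A).support)
    {j : Fin N} {i : ι} (hi : n (j, i) ≠ 0) : ∃ k ∈ A, χ k = i := by
  classical
  by_contra! h
  have h0 : pderiv (j, i) (outputState U χ A) = 0 := by
    rw [pderiv_outputState, Finset.filter_false_of_mem h, Finset.sum_empty]
  have hm : n - Finsupp.single (j, i) 1 + Finsupp.single (j, i) 1 = n :=
    tsub_add_cancel_of_le (Finsupp.single_le_iff.2 (Nat.one_le_iff_ne_zero.2 hi))
  have h1 := coeff_pderiv (i := (j, i)) (outputState U χ A) (n - Finsupp.single (j, i) 1)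
  rw [h0, coeff_zero, hm] at h1
  have h2 := mul_eq_zero.1 h1.symm
  refine h2.elim (mem_support_iff.1 hn) fun h3 => ?_
  exact Nat.cast_add_one_ne_zero _ h3

theorem eventProb_X_mul_le (Φ : Fock N ι) (x : Fin N × ι) {d : ℕ}
    (hd : ∀ n ∈ Φ.support, n x ≤ d) :
    eventProb (X x * Φ) Set.univ ≤ (d + 1) * eventProb Φ Set.univ := by
  classical
  rw [eventProb_eq_sum subset_rfl, eventProb_eq_sum subset_rfl, support_X_mul, Finset.sum_map,
    Finset.mul_sum]
  refine Finset.sum_le_sum fun n hn => ?_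
  have h1 : coeff (Finsupp.single x 1 + n) (X x * Φ) = coeff n Φ := coeff_X_mul _ _ _
  have h2 : occupationProb (X x * Φ) (addLeftEmbedding (Finsupp.single x 1) n) =
      (n x + 1) * occupationProb Φ n := by
    rw [addLeftEmbedding_apply, occupationProb, h1, add_comm, prod_factorial_add_single,
      occupationProb]
    ring
  simp only [Set.mem_univ, if_true, h2]
  have : (n x : ℝ) ≤ d := by exact_mod_cast hd n hn
  exact mul_le_mul_of_nonneg_right (by linarith) (occupationProb_nonneg Φ n)

/-- Event probabilities are bounded uniformly in the internal states.  (For unitary `U` the bound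
is `1`; any bound makes the mixture over internal states summable.) -/
theorem exists_eventProb_outputState_le (U : Matrix (Fin N) (Fin N) ℂ) (A : Finset (Fin N)) :
    ∃ M : ℝ, 0 ≤ M ∧ ∀ (χ : Fin N → ι) E, eventProb (outputState U χ A) E ≤ M := by
  classical
  suffices h : ∃ M : ℝ, 0 ≤ M ∧ ∀ χ : Fin N → ι, eventProb (outputState U χ A) Set.univ ≤ M by
    obtain ⟨M, hM, h⟩ := h
    exact ⟨M, hM, fun χ E => (eventProb_mono fun _ _ _ => Set.mem_univ _).trans (h χ)⟩
  induction A using Finset.induction_on with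
  | empty =>
    refine ⟨1, zero_le_one, fun χ => ?_⟩
    have h0 : (outputState U χ ∅).support ⊆ {0} := by
      simp [outputState]
    rw [eventProb_eq_sum h0]
    simp [occupationProb, outputState]
  | insert a A ha ih =>
    obtain ⟨M, hM, h⟩ := ih
    refine ⟨N * ∑ j, ‖U j a‖ ^ 2 * ((A.card + 1) * M), by positivity, fun χ => ?_⟩
    have h1 : outputState U χ (insert a A) =
        ∑ j, C (U j a) * (X (j, χ a) * outputState U χ A) := by
      refine (Finset.prod_insert ha).trans ?_
      rw [Finset.sum_mul]
      exact Finset.sum_congr rfl fun j _ => mul_assoc _ _ _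
    rw [h1]
    refine (eventProb_sum_le _ _ _).trans ?_
    rw [Finset.card_univ, Fintype.card_fin]
    gcongr with j
    rw [eventProb_C_mul]
    gcongr
    refine (eventProb_X_mul_le _ _ (d := A.card) fun n hn => ?_).trans ?_
    · rw [← degree_of_mem_support_outputState hn]
      exact Finsupp.le_degree _ _
    · gcongr
      exact h χ

/-- Probability that photon `k` leaves in mode `o` while the other photons are injected alone and
produce one of the patterns of `S` with mode `o` empty. -/
noncomputable def transferProb (U : Matrix (Fin N) (Fin N) ℂ) {o : Fin N} (S : Set (Pattern o))
    (χ : Fin N → ι) (k : Fin N) : ℝ :=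
  ‖U o k‖ ^ 2 * eventProb (outputState U χ (Finset.univ.erase k)) (vacuumEvent ι S)

theorem transferProb_nonneg (U : Matrix (Fin N) (Fin N) ℂ) {o : Fin N} (S : Set (Pattern o))
    (χ : Fin N → ι) (k : Fin N) : 0 ≤ transferProb U S χ k :=
  mul_nonneg (by positivity) (eventProb_nonneg _ _)

theorem transferProb_congr (U : Matrix (Fin N) (Fin N) ℂ) {o : Fin N} (S : Set (Pattern o))
    {χ χ' : Fin N → ι} {k : Fin N} (h : ∀ l, l ≠ k → χ l = χ' l) :
    transferProb U S χ k = transferProb U S χ' k := by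
  have : outputState U χ (Finset.univ.erase k) = outputState U χ' (Finset.univ.erase k) :=
    Finset.prod_congr rfl fun l hl => by rw [h l (Finset.ne_of_mem_erase hl)]
  rw [transferProb, transferProb, this]

theorem exists_transferProb_le (ι : Type*) (U : Matrix (Fin N) (Fin N) ℂ) {o : Fin N}
    (S : Set (Pattern o)) :
    ∃ M : ℝ, 0 ≤ M ∧ ∀ (χ : Fin N → ι) k, transferProb U S χ k ≤ M := by
  choose M hM h using fun k => exists_eventProb_outputState_le (ι := ι) U (Finset.univ.erase k)
  refine ⟨∑ k, ‖U o k‖ ^ 2 * M k, Finset.sum_nonneg fun k _ => mul_nonneg (by positivity) (hM k),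
    fun χ k => ?_⟩
  refine le_trans (mul_le_mul_of_nonneg_left (h k χ _) (by positivity)) ?_
  exact Finset.single_le_sum (f := fun k => ‖U o k‖ ^ 2 * M k)
    (fun k _ => mul_nonneg (by positivity) (hM k)) (Finset.mem_univ k)

variable {U : Matrix (Fin N) (Fin N) ℂ} {o : Fin N} {S : Set (Pattern o)}

theorem vacuumEvent_apply_eq_zero {m : Fin N × ι →₀ ℕ} (hm : m ∈ vacuumEvent ι S) (i : ι) :
    m (o, i) = 0 :=
  photonCount_eq_zero_iff.1 hm.1 i

theorem eventProb_singlePhotonEvent (Φ : Fock N ι) (i : ι) :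
    eventProb Φ (singlePhotonEvent S i) = eventProb (pderiv (o, i) Φ) (vacuumEvent ι S) :=
  (eventProb_pderiv Φ (o, i) fun _ hm => vacuumEvent_apply_eq_zero hm i).symm

/-- Heralding with the target state in mode `o` is detecting one photon in `(o, ψ)`. -/
theorem eventProb_herald_diff_error (hS : ∀ s ∈ S, s.LeavesOne) (χ : Fin N → ι) (ψ : ι) :
    eventProb (outputState U χ Finset.univ) (heraldEvent ι S \ errorEvent ψ o) =
      eventProb (outputState U χ Finset.univ) (singlePhotonEvent S ψ) := by
  refine eventProb_congr fun n hn => ?_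
  have hdeg : n.degree = N := by simpa using degree_of_mem_support_outputState hn
  constructor
  · rintro ⟨h, he⟩
    have h1 := photonCount_output_eq_one hS hdeg h
    refine mem_singlePhotonEvent_iff.2 ⟨h, h1, fun h0 => ?_⟩
    have : photonCount n o = 0 := photonCount_eq_zero_iff.2 fun i => by
      by_contra hi
      exact he ⟨i, fun hψ => hi (hψ ▸ h0), hi⟩
    omega
  · intro h
    have h' := mem_singlePhotonEvent_iff.1 h
    refine ⟨h'.1, ?_⟩
    rintro ⟨i, hi, hni⟩
    exact hi (singlePhotonEvent_disjoint (mem_singlePhotonEvent_iff.2 ⟨h'.1, h'.2.1, hni⟩) h)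

open Classical in
/-- The good photon in mode `o` may be any of the input photons in the state `ψ`.  These
alternatives interfere, but by Cauchy-Schwarz by a factor of at most `N`. -/
theorem eventProb_herald_diff_error_le (hS : ∀ s ∈ S, s.LeavesOne) (χ : Fin N → ι) (ψ : ι) :
    eventProb (outputState U χ Finset.univ) (heraldEvent ι S \ errorEvent ψ o) ≤
      N * ∑ k, if χ k = ψ then transferProb U S χ k else 0 := by
  rw [eventProb_herald_diff_error hS, eventProb_singlePhotonEvent, pderiv_outputState,
    ← Finset.sum_filter]
  refine (eventProb_sum_le _ _ _).trans ?_
  simp only [eventProb_C_mul]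
  refine mul_le_mul_of_nonneg_right ?_ (Finset.sum_nonneg fun k _ => transferProb_nonneg U S χ k)
  exact_mod_cast (Finset.card_le_univ _).trans_eq (Fintype.card_fin N)

open Classical in
/-- Bad photons that are distinguishable from all the others do not interfere. -/
theorem eventProb_error_inter_herald (hS : ∀ s ∈ S, s.LeavesOne) {χ : Fin N → ι} {ψ : ι}
    (hχ : ∀ k, χ k ≠ ψ → ∀ l, χ l = χ k → l = k) :
    eventProb (outputState U χ Finset.univ) (errorEvent ψ o ∩ heraldEvent ι S) =
      ∑ k, if χ k ≠ ψ then transferProb U S χ k else 0 := by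
  rw [← Finset.sum_filter, eventProb_eq_sum_of_partition
    (Finset.univ.filter fun k => χ k ≠ ψ) (fun k => singlePhotonEvent S (χ k))]
  · refine Finset.sum_congr rfl fun k hk => ?_
    have hk' : χ k ≠ ψ := (Finset.mem_filter.1 hk).2
    have : (Finset.univ.filter fun l => χ l = χ k) = {k} := by
      ext l
      simp only [Finset.mem_filter, Finset.mem_univ, true_and, Finset.mem_singleton]
      exact ⟨hχ k hk' l, fun h => h ▸ rfl⟩
    rw [eventProb_singlePhotonEvent, pderiv_outputState, this, Finset.sum_singleton,
      eventProb_C_mul, transferProb]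
  · intro n hn
    have hdeg : n.degree = N := by simpa using degree_of_mem_support_outputState hn
    constructor
    · rintro ⟨⟨i, hi, hni⟩, h⟩
      obtain ⟨k, -, rfl⟩ := exists_of_mem_support_outputState hn hni
      exact ⟨k, by simpa using hi, mem_singlePhotonEvent_iff.2
        ⟨h, photonCount_output_eq_one hS hdeg h, hni⟩⟩
    · rintro ⟨k, hk, h⟩
      have h' := mem_singlePhotonEvent_iff.1 h
      exact ⟨⟨χ k, (Finset.mem_filter.1 hk).2, h'.2.2⟩, h'.1⟩
  · intro k hk l _ n hn hn'
    exact (hχ k (Finset.mem_filter.1 hk).2 l (singlePhotonEvent_disjoint hn' hn)).symm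

end OutputState

/-! ### Averaging over the internal states -/

/-- Product distributions: a finite product of sums of nonnegative terms is the sum over all
choice functions. -/
theorem hasSum_prod_pi {κ ι : Type*} [Fintype κ] {f : κ → ι → ℝ} {a : κ → ℝ}
    (hf : ∀ k i, 0 ≤ f k i) (h : ∀ k, HasSum (f k) (a k)) :
    HasSum (fun χ : κ → ι => ∏ k, f k (χ k)) (∏ k, a k) := by
  suffices H : ∀ n (f : Fin n → ι → ℝ) (a : Fin n → ℝ), (∀ k i, 0 ≤ f k i) →
      (∀ k, HasSum (f k) (a k)) → HasSum (fun χ : Fin n → ι => ∏ k, f k (χ k)) (∏ k, a k) by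
    let e := Fintype.equivFin κ
    have h1 := H _ (fun k => f (e.symm k)) (fun k => a (e.symm k)) (fun k => hf _) fun k => h _
    rw [← (Equiv.arrowCongr e.symm (Equiv.refl ι)).hasSum_iff, ← e.symm.prod_comp a]
    refine h1.congr_fun fun χ => ?_
    simp [← e.symm.prod_comp]
  intro n
  induction n with
  | zero => exact fun f a _ _ => by simp
  | succ n ih =>
    intro f a hf h
    have h1 := ih (fun k => f k.succ) (fun k => a k.succ) (fun k => hf _) fun k => h _
    have hnn : ∀ χ : Fin n → ι, 0 ≤ ∏ k, f k.succ (χ k) :=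
      fun χ => Finset.prod_nonneg fun k _ => hf _ _
    have hs := (h 0).summable.mul_of_nonneg h1.summable (fun i => hf 0 i) hnn
    have h2 := (h 0).mul h1 hs
    rw [← (Fin.consEquiv fun _ => ι).hasSum_iff, Fin.prod_univ_succ]
    refine h2.congr_fun fun χ => ?_
    simp [Fin.prod_univ_succ]

section Mixture

variable {N : ℕ} {ι : Type*} (src : OrthogonalBadBits N ι)

theorem weight_target (ε : ℝ) (k : Fin N) : src.weight ε k src.ψ = 1 - ε := by
  simp [OrthogonalBadBits.weight, src.orthogonal_target]

theorem weight_of_ne (ε : ℝ) (k : Fin N) {i : ι} (h : i ≠ src.ψ) :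
    src.weight ε k i = ε * src.p k i := by
  simp [OrthogonalBadBits.weight, h]

theorem weight_nonneg {ε : ℝ} (hε : ε ∈ Set.Icc (0 : ℝ) 1) (k : Fin N) (i : ι) :
    0 ≤ src.weight ε k i := by
  by_cases h : i = src.ψ
  · rw [h, weight_target]; linarith [hε.2]
  · rw [weight_of_ne src ε k h]; exact mul_nonneg hε.1 (src.nonneg k i)

open Classical in
theorem hasSum_weight_target (ε : ℝ) (k : Fin N) :
    HasSum (fun i => src.weight ε k i * if i = src.ψ then 1 else 0) (1 - ε) := by
  have := hasSum_single (f := fun i => src.weight ε k i * if i = src.ψ then 1 else 0) src.ψ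
    fun i hi => by simp [hi]
  simpa [weight_target] using this

open Classical in
theorem hasSum_weight_bad (ε : ℝ) (k : Fin N) :
    HasSum (fun i => src.weight ε k i * if i ≠ src.ψ then 1 else 0) ε := by
  have h := (src.hasSum_one k).mul_left ε
  rw [mul_one] at h
  refine h.congr_fun fun i => ?_
  by_cases hi : i = src.ψ
  · simp [hi, src.orthogonal_target]
  · simp [hi, weight_of_ne]

theorem hasSum_weight (ε : ℝ) (k : Fin N) : HasSum (src.weight ε k) 1 := by
  classical
  have h := (hasSum_weight_target src ε k).add (hasSum_weight_bad src ε k)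
  rw [sub_add_cancel] at h
  refine h.congr_fun fun i => ?_
  by_cases hi : i = src.ψ <;> simp [hi]

theorem prod_weight_nonneg {ε : ℝ} (hε : ε ∈ Set.Icc (0 : ℝ) 1) (χ : Fin N → ι) :
    0 ≤ ∏ k, src.weight ε k (χ k) :=
  Finset.prod_nonneg fun k _ => weight_nonneg src hε k _

/-- Internal states of positive probability: a bad photon differs from all the other photons. -/
theorem eq_of_prod_weight_ne_zero {ε : ℝ} {χ : Fin N → ι}
    (h : ∏ k, src.weight ε k (χ k) ≠ 0) (k : Fin N) (hk : χ k ≠ src.ψ) (l : Fin N)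
    (hl : χ l = χ k) : l = k := by
  by_contra hlk
  have hw := fun k => Finset.prod_ne_zero_iff.1 h k (Finset.mem_univ k)
  have h1 := hw k
  have h2 := hw l
  rw [weight_of_ne src ε k hk] at h1
  rw [hl, weight_of_ne src ε l hk] at h2
  exact (src.orthogonal_bad l k hlk (χ k)).elim (right_ne_zero_of_mul h2) (right_ne_zero_of_mul h1)

theorem summable_prod_weight_mul {κ : Type*} [Fintype κ] (c : κ → Fin N) {ε : ℝ}
    (hε : ε ∈ Set.Icc (0 : ℝ) 1) {g : (κ → ι) → ℝ} {M : ℝ} (h0 : ∀ χ, 0 ≤ g χ)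
    (hM : ∀ χ, g χ ≤ M) : Summable fun χ : κ → ι => (∏ k, src.weight ε (c k) (χ k)) * g χ := by
  have h := hasSum_prod_pi (f := fun k => src.weight ε (c k))
    (fun k => weight_nonneg src hε (c k)) fun k => hasSum_weight src ε (c k)
  have hw : ∀ χ : κ → ι, 0 ≤ ∏ k, src.weight ε (c k) (χ k) := fun χ =>
    Finset.prod_nonneg fun k _ => weight_nonneg src hε _ _
  exact Summable.of_nonneg_of_le (fun χ => mul_nonneg (hw χ) (h0 χ))
    (fun χ => mul_le_mul_of_nonneg_left (hM χ) (hw χ)) (h.summable.mul_right M)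

/-- `transferProb` averaged over the internal states of all photons other than `k`; it does not
depend on the state of photon `k`. -/
noncomputable def meanTransferProb (U : Matrix (Fin N) (Fin N) ℂ) {o : Fin N}
    (S : Set (Pattern o)) (ε : ℝ) (k : Fin N) : ℝ :=
  ∑' χ : {l // l ≠ k} → ι, (∏ l : {l // l ≠ k}, src.weight ε l (χ l)) *
    transferProb U S ((Equiv.funSplitAt k ι).symm (src.ψ, χ)) k

variable (U : Matrix (Fin N) (Fin N) ℂ) {o : Fin N} (S : Set (Pattern o)) {ε : ℝ}

theorem meanTransferProb_nonneg (hε : ε ∈ Set.Icc (0 : ℝ) 1) (k : Fin N) :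
    0 ≤ meanTransferProb src U S ε k :=
  tsum_nonneg fun _ => mul_nonneg (Finset.prod_nonneg fun _ _ => weight_nonneg src hε _ _)
    (transferProb_nonneg U S _ k)

/-- The state of photon `k` is independent of the states of the other photons. -/
theorem hasSum_weight_mul_transferProb (hε : ε ∈ Set.Icc (0 : ℝ) 1) (k : Fin N) {g : ι → ℝ}
    (hg : ∀ i, 0 ≤ g i) {c : ℝ} (hc : HasSum (fun i => src.weight ε k i * g i) c) :
    HasSum (fun χ : Fin N → ι => (∏ l, src.weight ε l (χ l)) * (g (χ k) * transferProb U S χ k))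
      (c * meanTransferProb src U S ε k) := by
  obtain ⟨M, -, hM⟩ := exists_transferProb_le ι U S
  have h1 : Summable fun χ : {l // l ≠ k} → ι => (∏ l : {l // l ≠ k}, src.weight ε l (χ l)) *
      transferProb U S ((Equiv.funSplitAt k ι).symm (src.ψ, χ)) k :=
    summable_prod_weight_mul src _ hε (fun χ => transferProb_nonneg U S _ k) fun χ => hM _ k
  have h2 := hc.mul h1.hasSum (hc.summable.mul_of_nonneg h1
    (fun i => mul_nonneg (weight_nonneg src hε k i) (hg i)) fun χ => mul_nonneg
      (Finset.prod_nonneg fun _ _ => weight_nonneg src hε _ _) (transferProb_nonneg U S _ k))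
  rw [← (Equiv.funSplitAt k ι).symm.hasSum_iff]
  refine h2.congr_fun ?_
  rintro ⟨i, χ⟩
  have h3 : transferProb U S ((Equiv.funSplitAt k ι).symm (i, χ)) k =
      transferProb U S ((Equiv.funSplitAt k ι).symm (src.ψ, χ)) k :=
    transferProb_congr U S fun l hl => by simp [Equiv.funSplitAt, hl]
  have h4 : ∀ l : {l // l ≠ k}, (Equiv.funSplitAt k ι).symm (i, χ) l = χ l := fun l => by
    simp [Equiv.funSplitAt, l.2]
  have h5 : (Equiv.funSplitAt k ι).symm (i, χ) k = i := by simp [Equiv.funSplitAt]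
  simp only [Function.comp_apply]
  rw [h3, h5, Fintype.prod_eq_mul_prod_subtype_ne _ k, h5]
  simp only [h4]
  ring

variable {S}

/-- Exactly, the joint probability of error and herald is `ε` times the sum over `k` of the mean
probability that photon `k` goes to `o`: this photon must be bad, and does not interfere. -/
theorem hasSum_error_inter_herald (hS : ∀ s ∈ S, s.LeavesOne) (hε : ε ∈ Set.Icc (0 : ℝ) 1) :
    HasSum (fun χ : Fin N → ι => (∏ k, src.weight ε k (χ k)) *
        eventProb (linearOptics U (inputState χ)) (errorEvent src.ψ o ∩ heraldEvent ι S))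
      (ε * ∑ k, meanTransferProb src U S ε k) := by
  classical
  rw [Finset.mul_sum]
  have h := hasSum_sum (s := Finset.univ) fun k _ =>
    hasSum_weight_mul_transferProb src U S hε k (fun i => by split_ifs <;> simp)
      (hasSum_weight_bad src ε k)
  refine h.congr_fun fun χ => ?_
  rw [← Finset.mul_sum, linearOptics_inputState]
  by_cases hw : ∏ k, src.weight ε k (χ k) = 0
  · simp [hw]
  · rw [eventProb_error_inter_herald hS (eq_of_prod_weight_ne_zero src hw)]
    simp

theorem outputProb_error_inter_herald (hS : ∀ s ∈ S, s.LeavesOne)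
    (hε : ε ∈ Set.Icc (0 : ℝ) 1) :
    outputProb src U ε (errorEvent src.ψ o ∩ heraldEvent ι S) =
      ε * ∑ k, meanTransferProb src U S ε k :=
  (hasSum_error_inter_herald src U hS hε).tsum_eq

theorem summable_weight_mul_eventProb (hε : ε ∈ Set.Icc (0 : ℝ) 1)
    (E : Set (Fin N × ι →₀ ℕ)) :
    Summable fun χ : Fin N → ι => (∏ k, src.weight ε k (χ k)) *
      eventProb (linearOptics U (inputState χ)) E := by
  obtain ⟨M, -, hM⟩ := exists_eventProb_outputState_le (ι := ι) U Finset.univ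
  exact summable_prod_weight_mul src id hε (fun χ => eventProb_nonneg _ _)
    fun χ => by rw [linearOptics_inputState]; exact hM χ E

theorem heraldProb_le (hS : ∀ s ∈ S, s.LeavesOne) (hε : ε ∈ Set.Icc (0 : ℝ) 1) :
    heraldProb src U S ε ≤ (ε + N * (1 - ε)) * ∑ k, meanTransferProb src U S ε k := by
  classical
  have h1 := hasSum_error_inter_herald src U hS hε
  have h2 : HasSum (fun χ : Fin N → ι => (∏ k, src.weight ε k (χ k)) *
      (N * ∑ k, if χ k = src.ψ then transferProb U S χ k else 0))
      (N * ((1 - ε) * ∑ k, meanTransferProb src U S ε k)) := by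
    rw [Finset.mul_sum]
    have h := (hasSum_sum (s := Finset.univ) fun k _ =>
      hasSum_weight_mul_transferProb src U S hε k (fun i => by split_ifs <;> simp)
        (hasSum_weight_target src ε k)).mul_left (N : ℝ)
    refine h.congr_fun fun χ => ?_
    rw [← Finset.mul_sum, mul_left_comm]
    simp
  have h3 := h1.add h2
  refine (hasSum_le (fun χ => ?_)
    (summable_weight_mul_eventProb src U hε (heraldEvent ι S)).hasSum h3).trans_eq ?_
  · rw [← mul_add]
    refine mul_le_mul_of_nonneg_left ?_ (prod_weight_nonneg src hε χ)
    rw [← eventProb_inter_add_diff _ (heraldEvent ι S) (errorEvent src.ψ o)]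
    refine add_le_add_right ?_ _
    rw [linearOptics_inputState]
    exact eventProb_herald_diff_error_le hS χ src.ψ
  · ring

/-- The lower bound holds exactly, without a quadratic correction. -/
theorem div_le_distilledError (hS : ∀ s ∈ S, s.LeavesOne) (hε : ε ∈ Set.Icc (0 : ℝ) 1)
    (h : 0 < heraldProb src U S ε) : ε / N ≤ distilledError src U S ε := by
  have hN : (1 : ℝ) ≤ N := by exact_mod_cast o.pos
  have hR : 0 ≤ ∑ k, meanTransferProb src U S ε k :=
    Finset.sum_nonneg fun k _ => meanTransferProb_nonneg src U S hε k
  rw [distilledError, outputProb_error_inter_herald src U hS hε,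
    div_le_div_iff₀ (by linarith) h]
  have h1 := mul_le_mul_of_nonneg_left (heraldProb_le src U hS hε) hε.1
  have h2 : 0 ≤ ε * (∑ k, meanTransferProb src U S ε k) * ((N - 1) * ε) :=
    mul_nonneg (mul_nonneg hε.1 hR) (mul_nonneg (by linarith) hε.1)
  nlinarith

theorem distilledError_le_one (hε : ε ∈ Set.Icc (0 : ℝ) 1) (h : 0 < heraldProb src U S ε) :
    distilledError src U S ε ≤ 1 := by
  rw [distilledError, div_le_one h]
  refine (summable_weight_mul_eventProb src U hε _).tsum_le_tsum (fun χ => ?_)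
    (summable_weight_mul_eventProb src U hε _)
  exact mul_le_mul_of_nonneg_left (eventProb_mono fun _ _ h => h.2) (prod_weight_nonneg src hε χ)

theorem le_heraldProb (hε : ε ∈ Set.Icc (0 : ℝ) 1) :
    (1 - ε) ^ N * idealHeraldProb src U S ≤ heraldProb src U S ε := by
  have h := (summable_weight_mul_eventProb src U hε (heraldEvent ι S)).le_tsum
    (fun _ => src.ψ) fun χ _ => mul_nonneg (prod_weight_nonneg src hε χ) (eventProb_nonneg _ _)
  simp only [weight_target, Finset.prod_const, Finset.card_univ, Fintype.card_fin] at h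
  exact h

theorem meanTransferProb_le {M : ℝ} (hM0 : 0 ≤ M)
    (hM : ∀ (χ : Fin N → ι) k, transferProb U S χ k ≤ M)
    (hε : ε ∈ Set.Icc (0 : ℝ) 1) (k : Fin N) :
    meanTransferProb src U S ε k ≤ transferProb U S (fun _ => src.ψ) k + N * M * ε := by
  classical
  set T := transferProb U S (fun _ => src.ψ) k
  have hT : 0 ≤ T := transferProb_nonneg U S _ k
  have h1 := (hasSum_prod_pi (f := fun l : {l // l ≠ k} => src.weight ε l)
    (fun l => weight_nonneg src hε l) fun l => hasSum_weight src ε l).mul_right M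
  have hcard : Fintype.card {l // l ≠ k} = N - 1 := by simp
  have h2 : HasSum (fun χ : {l // l ≠ k} → ι =>
      if χ = (fun _ => src.ψ) then (1 - ε) ^ (N - 1) * (T - M) else 0)
      ((1 - ε) ^ (N - 1) * (T - M)) := hasSum_ite_eq _ _
  have h3 := h1.add h2
  refine (hasSum_le (fun χ => ?_) (summable_prod_weight_mul src
    (fun l : {l // l ≠ k} => (l : Fin N)) hε (fun χ => transferProb_nonneg U S
      ((Equiv.funSplitAt k ι).symm (src.ψ, χ)) k) fun χ => hM _ k).hasSum h3).trans ?_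
  · by_cases hχ : χ = fun _ => src.ψ
    · have hc : (Equiv.funSplitAt k ι).symm (src.ψ, fun _ => src.ψ) = fun _ => src.ψ := by
        funext l
        simp [Equiv.funSplitAt]
      have hw : ∏ l : {l // l ≠ k}, src.weight ε l src.ψ = (1 - ε) ^ (N - 1) := by
        simp only [weight_target, Finset.prod_const, Finset.card_univ, hcard]
      simp only [hχ, hc, hw, if_true]
      apply le_of_eq
      change _ * T = _
      ring
    · simp only [hχ, if_false, add_zero]
      exact mul_le_mul_of_nonneg_left (hM _ k)
        (Finset.prod_nonneg fun l _ => weight_nonneg src hε _ _)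
  · have hN : ((N - 1 : ℕ) : ℝ) ≤ N := by exact_mod_cast Nat.sub_le N 1
    have hb := one_add_mul_le_pow (a := -ε) (by linarith [hε.2]) (N - 1)
    rw [← sub_eq_add_neg] at hb
    have hp : (1 - ε) ^ (N - 1) ≤ 1 := pow_le_one₀ (by linarith [hε.2]) (by linarith [hε.1])
    have hq : (1 : ℝ) - (1 - ε) ^ (N - 1) ≤ N * ε := by nlinarith [hε.1]
    have e1 := mul_le_mul_of_nonneg_right hq hM0
    have e2 := mul_le_mul_of_nonneg_right hp hT
    simp only [Finset.prod_const_one]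
    nlinarith

/-- If for ideal photons the `N` alternatives for the photon in mode `o` interfere fully
constructively, then the lower bound is attained to first order. -/
theorem exists_abs_distilledError_sub_le (hS : ∀ s ∈ S, s.LeavesOne)
    (hpos : 0 < idealHeraldProb src U S)
    (hU : idealHeraldProb src U S = N * ∑ k, transferProb U S (fun _ => src.ψ) k) :
    ∃ C : ℝ, ∀ ε ∈ Set.Ico (0 : ℝ) 1, 0 < heraldProb src U S ε ∧
      |distilledError src U S ε - ε / N| ≤ C * ε ^ 2 := by
  obtain ⟨M, hM0, hM⟩ := exists_transferProb_le ι U S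
  set p := idealHeraldProb src U S
  have hN : (1 : ℝ) ≤ N := by exact_mod_cast o.pos
  set K : ℝ := N * (N * M) with hK
  have hK0 : 0 ≤ K := by positivity
  refine ⟨4 + 2 ^ N * (1 + K / p), fun ε hε' => ?_⟩
  have hε : ε ∈ Set.Icc (0 : ℝ) 1 := ⟨hε'.1, hε'.2.le⟩
  have h1 : 0 < 1 - ε := by linarith [hε'.2]
  have hher := le_heraldProb src U (S := S) hε
  have hher0 : 0 < heraldProb src U S ε := lt_of_lt_of_le (mul_pos (pow_pos h1 N) hpos) hher
  have hlow := div_le_distilledError src U hS hε hher0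
  have hC0 : 0 ≤ 2 ^ N * (1 + K / p) := by positivity
  have hεN : 0 ≤ ε / N := div_nonneg hε.1 (by linarith)
  refine ⟨hher0, ?_⟩
  rw [abs_of_nonneg (by linarith)]
  rcases le_or_gt (1 / 2) ε with hhalf | hhalf
  · have := distilledError_le_one src U hε hher0
    nlinarith [mul_nonneg hC0 (sq_nonneg ε)]
  · have hsum : ∑ k, meanTransferProb src U S ε k ≤ p / N + K * ε := by
      refine (Finset.sum_le_sum fun k _ => meanTransferProb_le src U hM0 hM hε k).trans_eq ?_
      rw [Finset.sum_add_distrib, hU, mul_div_cancel_left₀ _ (by linarith)]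
      simp [hK, mul_assoc]
    have hq : 1 - N * ε ≤ (1 - ε) ^ N := by
      have := one_add_mul_le_pow (a := -ε) (by linarith) N
      rw [← sub_eq_add_neg] at this
      linarith
    have hq2 : 1 ≤ 2 ^ N * (1 - ε) ^ N := by
      rw [← mul_pow]
      exact one_le_pow₀ (by linarith)
    -- With `q = (1 - ε) ^ N`: `1 - q ≤ N * ε` and `1 ≤ 2 ^ N * q`.
    have key : p / N + K * ε ≤ (1 / N + 2 ^ N * (1 + K / p) * ε) * ((1 - ε) ^ N * p) := by
      have e1 : (1 / N + 2 ^ N * (1 + K / p) * ε) * ((1 - ε) ^ N * p) =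
          p / N * (1 - ε) ^ N + (2 ^ N * (1 - ε) ^ N) * ((p + K) * ε) := by
        field_simp
      have e2 : p / N * (1 - N * ε) ≤ p / N * (1 - ε) ^ N :=
        mul_le_mul_of_nonneg_left hq (by positivity)
      have e3 : p / N * (1 - N * ε) = p / N - p * ε := by field_simp
      have e4 : 1 * ((p + K) * ε) ≤ (2 ^ N * (1 - ε) ^ N) * ((p + K) * ε) :=
        mul_le_mul_of_nonneg_right hq2 (mul_nonneg (by linarith) hε.1)
      rw [e1]
      linarith
    have hmain : distilledError src U S ε ≤ ε * (1 / N + 2 ^ N * (1 + K / p) * ε) := by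
      rw [distilledError, outputProb_error_inter_herald src U hS hε, div_le_iff₀ hher0, mul_assoc]
      refine mul_le_mul_of_nonneg_left ?_ hε.1
      refine hsum.trans (key.trans (mul_le_mul_of_nonneg_left hher ?_))
      exact add_nonneg (by positivity) (mul_nonneg hC0 hε.1)
    have e5 : ε * (1 / N + 2 ^ N * (1 + K / p) * ε) =
        ε / N + 2 ^ N * (1 + K / p) * ε ^ 2 := by ring
    nlinarith [sq_nonneg ε]

end Mixture

/-! ### The Fourier matrix -/

section Fourier

variable {N : ℕ}

/-- The primitive `N`-th root of unity `exp (2 π i / N)`. -/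
noncomputable def fourierRoot (N : ℕ) : ℂ :=
  Complex.exp (2 * Real.pi * Complex.I / N)

theorem isPrimitiveRoot_fourierRoot [NeZero N] : IsPrimitiveRoot (fourierRoot N) N :=
  Complex.isPrimitiveRoot_exp N (NeZero.ne N)

theorem fourierRoot_ne_zero : fourierRoot N ≠ 0 :=
  Complex.exp_ne_zero _

theorem fourierMatrix_apply (j k : Fin N) :
    fourierMatrix N j k = fourierRoot N ^ ((j : ℕ) * k) / (Real.sqrt N : ℂ) := by
  rw [fourierMatrix, Matrix.of_apply, fourierRoot, ← Complex.exp_nat_mul]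
  congr 2
  push_cast
  ring

theorem fourierMatrix_symm (j k : Fin N) : fourierMatrix N j k = fourierMatrix N k j := by
  rw [fourierMatrix_apply, fourierMatrix_apply, mul_comm]

theorem fourierMatrix_ne_zero [NeZero N] (j k : Fin N) : fourierMatrix N j k ≠ 0 := by
  rw [fourierMatrix_apply]
  refine div_ne_zero (pow_ne_zero _ fourierRoot_ne_zero) ?_
  have : (0 : ℝ) < N := by exact_mod_cast NeZero.pos N
  exact_mod_cast (Real.sqrt_pos.2 this).ne'

/-- Shifting the column index multiplies row `j` by a phase. -/
theorem fourierMatrix_add [NeZero N] (j k a : Fin N) :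
    fourierMatrix N j (k + a) = (fourierRoot N ^ (a : ℕ)) ^ (j : ℕ) * fourierMatrix N j k := by
  have h : (fourierRoot N ^ (j : ℕ)) ^ N = 1 := by
    rw [← pow_mul, mul_comm, pow_mul, isPrimitiveRoot_fourierRoot.pow_eq_one, one_pow]
  rw [fourierMatrix_apply, fourierMatrix_apply, Fin.val_add, pow_mul, ← pow_eq_pow_mod _ h,
    mul_div_assoc', ← pow_mul, ← pow_mul, ← pow_add]
  congr 2
  ring

theorem fourierMatrix_mem_unitaryGroup [NeZero N] :
    fourierMatrix N ∈ Matrix.unitaryGroup (Fin N) ℂ := by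
  have hω := isPrimitiveRoot_fourierRoot (N := N)
  have hn : ‖fourierRoot N‖ = 1 := Complex.norm_eq_one_of_pow_eq_one hω.pow_eq_one (NeZero.ne N)
  have hN : (0 : ℝ) < N := by exact_mod_cast NeZero.pos N
  have hs : (Real.sqrt N : ℂ) * (Real.sqrt N : ℂ) = N := by
    rw [← Complex.ofReal_mul, Real.mul_self_sqrt hN.le, Complex.ofReal_natCast]
  have hc : (starRingEnd ℂ) (fourierRoot N) * fourierRoot N = 1 := by
    rw [mul_comm, Complex.mul_conj, Complex.normSq_eq_norm_sq, hn]
    simp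
  rw [Matrix.mem_unitaryGroup_iff']
  ext j k
  set z := (starRingEnd ℂ) (fourierRoot N) ^ (j : ℕ) * fourierRoot N ^ (k : ℕ) with hz
  have h1 : (star (fourierMatrix N) * fourierMatrix N) j k =
      (∑ l ∈ Finset.range N, z ^ l) / N := by
    rw [Matrix.mul_apply, ← Fin.sum_univ_eq_sum_range, Finset.sum_div]
    refine Finset.sum_congr rfl fun l _ => ?_
    rw [Matrix.star_apply, fourierMatrix_apply, fourierMatrix_apply, RCLike.star_def, map_div₀,
      map_pow, Complex.conj_ofReal, div_mul_div_comm, hs, hz, mul_pow, ← pow_mul, ← pow_mul,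
      mul_comm (l : ℕ), mul_comm (l : ℕ)]
  rw [h1]
  have hN' : (N : ℂ) ≠ 0 := by exact_mod_cast hN.ne'
  by_cases hjk : j = k
  · have hz1 : z = 1 := by rw [hz, hjk, ← mul_pow, hc, one_pow]
    subst hjk
    simp [hz1, hN']
  · have hz1 : z ≠ 1 := by
      intro h
      have h2 : fourierRoot N ^ (k : ℕ) = fourierRoot N ^ (j : ℕ) := by
        calc fourierRoot N ^ (k : ℕ)
            = ((starRingEnd ℂ) (fourierRoot N) * fourierRoot N) ^ (j : ℕ) *
                fourierRoot N ^ (k : ℕ) := by rw [hc, one_pow, one_mul]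
          _ = fourierRoot N ^ (j : ℕ) * z := by rw [hz]; ring
          _ = fourierRoot N ^ (j : ℕ) := by rw [h, mul_one]
      exact hjk (Fin.ext (hω.pow_inj k.2 j.2 h2)).symm
    have hzN : z ^ N = 1 := by
      rw [hz, mul_pow, ← pow_mul, ← pow_mul, mul_comm _ N, mul_comm _ N, pow_mul, pow_mul,
        ← map_pow, hω.pow_eq_one]
      simp
    rw [geom_sum_eq hz1, hzN]
    simp [hjk]

end Fourier

/-! ### Fourier interference of ideal photons -/

section FourierInterference

variable {N : ℕ} {ι : Type*}

/-- The effect of phase shifters on amplitudes. -/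
theorem coeff_aeval_C_mul_X {σ : Type*} (c : σ → ℂ) (Φ : MvPolynomial σ ℂ) (n : σ →₀ ℕ) :
    coeff n (aeval (fun x => C (c x) * X x) Φ : MvPolynomial σ ℂ) =
      (n.prod fun x e => c x ^ e) * coeff n Φ := by
  classical
  induction Φ using MvPolynomial.induction_on' with
  | monomial m a =>
    have h : (aeval (fun x => C (c x) * X x) (monomial m a) : MvPolynomial σ ℂ) =
        monomial m ((m.prod fun x e => c x ^ e) * a) := by
      rw [aeval_monomial, monomial_eq, C_mul, mul_assoc, mul_left_comm, algebraMap_eq]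
      congr 1
      simp only [mul_pow, Finsupp.prod, Finset.prod_mul_distrib, map_prod, map_pow]
    rw [h, coeff_monomial, coeff_monomial]
    split_ifs with hm
    · rw [hm]
    · rw [mul_zero]
  | add p q hp hq => rw [map_add, coeff_add, coeff_add, hp, hq, mul_add]

/-- The sum of the mode labels of all photons. -/
def totalLabel (n : Fin N × ι →₀ ℕ) : ℕ := ∑ j : Fin N, (j : ℕ) * photonCount n j

theorem totalLabel_eq_sum (n : Fin N × ι →₀ ℕ) :
    totalLabel n = n.sum fun x c => (x.1 : ℕ) * c := by
  simp only [totalLabel, photonCount, Finsupp.sum, Finset.mul_sum]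
  rw [Finset.sum_comm]
  simp

/-- A cyclic shift of the input modes of the Fourier network amounts to phase shifts at the output:
the amplitude of `n` acquires a phase given by `totalLabel n`. -/
theorem coeff_outputState_fourier_shift [NeZero N] (ψ : ι) (A : Finset (Fin N)) (a : Fin N)
    (n : Fin N × ι →₀ ℕ) :
    coeff n (outputState (fourierMatrix N) (fun _ => ψ) (A.map (Equiv.addRight a).toEmbedding)) =
      (fourierRoot N ^ (a : ℕ)) ^ totalLabel n *
        coeff n (outputState (fourierMatrix N) (fun _ => ψ) A) := by
  have h : outputState (fourierMatrix N) (fun _ => ψ) (A.map (Equiv.addRight a).toEmbedding) =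
      aeval (fun x : Fin N × ι => C ((fourierRoot N ^ (a : ℕ)) ^ (x.1 : ℕ)) * X x)
        (outputState (fourierMatrix N) (fun _ => ψ) A) := by
    rw [outputState, Finset.prod_map, outputState, map_prod]
    refine Finset.prod_congr rfl fun k _ => ?_
    rw [map_sum]
    refine Finset.sum_congr rfl fun j _ => ?_
    simp only [Equiv.coe_toEmbedding, Equiv.coe_addRight]
    rw [fourierMatrix_add, C_mul]
    simp only [map_mul, aeval_X, algHom_C, algebraMap_eq]
    ring
  rw [h, coeff_aeval_C_mul_X, totalLabel_eq_sum]
  congr 1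
  simp only [Finsupp.prod, Finsupp.sum, ← pow_mul, Finset.prod_pow_eq_pow_sum, Finset.mul_sum,
    mul_assoc]

/-- The suppression law: an amplitude of the full output state vanishes unless the phase acquired
under cyclic shifts is trivial. -/
theorem pow_totalLabel_eq_one [NeZero N] {ψ : ι} {n : Fin N × ι →₀ ℕ}
    (hn : coeff n (outputState (fourierMatrix N) (fun _ => ψ) Finset.univ) ≠ 0) (a : Fin N) :
    (fourierRoot N ^ (a : ℕ)) ^ totalLabel n = 1 := by
  have h := coeff_outputState_fourier_shift ψ Finset.univ a n
  rw [Finset.map_univ_equiv] at h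
  exact mul_right_cancel₀ hn (h.symm.trans (one_mul _).symm)

theorem totalLabel_eq_add_of_mem_heraldEvent {o : Fin N} {s : Pattern o}
    {n : Fin N × ι →₀ ℕ} (h : n ∈ heraldEvent ι {s}) :
    totalLabel n = o * photonCount n o + ∑ j : {j : Fin N // j ≠ o}, (j : ℕ) * s j := by
  rw [totalLabel, Fintype.sum_eq_add_sum_subtype_ne _ o]
  congr 1
  exact Finset.sum_congr rfl fun j _ => congrArg (fun t => (j : ℕ) * t) (congrFun h j)

/-- For a pattern that is not suppressed, the amplitudes of the `N` alternatives for the photon in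
mode `o` agree. -/
theorem fourier_amplitude_eq [NeZero N] {o : Fin N} {ψ : ι} {s : Pattern o} (hs : s.LeavesOne)
    (hpos : 0 < eventProb (outputState (fourierMatrix N) (fun _ => ψ) Finset.univ)
      (heraldEvent ι {s}))
    {m : Fin N × ι →₀ ℕ} (hm : m ∈ vacuumEvent ι {s}) (a : Fin N) :
    fourierMatrix N o a *
        coeff m (outputState (fourierMatrix N) (fun _ => ψ) (Finset.univ.erase a)) =
      fourierMatrix N o 0 *
        coeff m (outputState (fourierMatrix N) (fun _ => ψ) (Finset.univ.erase 0)) := by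
  obtain ⟨n, hn, hc⟩ := eventProb_pos_iff.1 hpos
  have hphase := pow_totalLabel_eq_one hc a
  have hdeg : n.degree = N := by
    simpa using degree_of_mem_support_outputState (mem_support_iff.2 hc)
  have h1 : photonCount n o = 1 :=
    photonCount_output_eq_one (S := {s}) (by simpa using hs) hdeg hn
  have h2 : totalLabel n = o + totalLabel m := by
    rw [totalLabel_eq_add_of_mem_heraldEvent hn, totalLabel_eq_add_of_mem_heraldEvent hm.2, h1,
      hm.1]
    simp
  have h3 : (Finset.univ.erase (0 : Fin N)).map (Equiv.addRight a).toEmbedding =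
      Finset.univ.erase a := by
    rw [Finset.map_erase, Finset.map_univ_equiv]
    simp
  have h4 := fourierMatrix_add o 0 a
  rw [zero_add] at h4
  rw [← h3, coeff_outputState_fourier_shift, h4]
  rw [h2, pow_add] at hphase
  linear_combination (fourierMatrix N o 0 *
    coeff m (outputState (fourierMatrix N) (fun _ => ψ) (Finset.univ.erase 0))) * hphase

/-- Full constructive interference: the Fourier matrix attains equality in the Cauchy-Schwarz
inequality. -/
theorem idealHeraldProb_fourier (src : OrthogonalBadBits N ι) {o : Fin N} {S : Set (Pattern o)}
    (hS : ∀ s ∈ S, s.LeavesOne ∧ 0 < idealHeraldProb src (fourierMatrix N) {s}) :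
    idealHeraldProb src (fourierMatrix N) S =
      N * ∑ k, transferProb (fourierMatrix N) S (fun _ => src.ψ) k := by
  classical
  have : NeZero N := ⟨o.pos.ne'⟩
  have hS' : ∀ s ∈ S, s.LeavesOne := fun s hs => (hS s hs).1
  rw [idealHeraldProb, linearOptics_inputState,
    ← eventProb_inter_add_diff _ (heraldEvent ι S) (errorEvent src.ψ o),
    eventProb_error_inter_herald hS' (fun k hk => absurd rfl hk),
    eventProb_herald_diff_error hS', eventProb_singlePhotonEvent, pderiv_outputState,
    Finset.filter_true_of_mem fun _ _ => rfl, eventProb_sum_of_coeff_eq]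
  · simp [eventProb_C_mul, transferProb]
  · intro m hm k _ l _
    set s : Pattern o := fun j => photonCount m j
    have hs := hS s hm.2
    rw [idealHeraldProb, linearOptics_inputState] at hs
    have hms : m ∈ vacuumEvent ι {s} := ⟨hm.1, rfl⟩
    rw [coeff_C_mul, coeff_C_mul, fourier_amplitude_eq hs.1 hs.2 hms k,
      fourier_amplitude_eq hs.1 hs.2 hms l]

/-! ### A pattern that is not suppressed -/

theorem coeff_add_single_outputState (U : Matrix (Fin N) (Fin N) ℂ) (ψ : ι)
    (A : Finset (Fin N)) (j : Fin N) {m : Fin N × ι →₀ ℕ} (hm : m (j, ψ) = 0) :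
    coeff (m + Finsupp.single (j, ψ) 1) (outputState U (fun _ => ψ) A) =
      ∑ k ∈ A, U j k * coeff m (outputState U (fun _ => ψ) (A.erase k)) := by
  classical
  have h := coeff_pderiv (i := (j, ψ)) (outputState U (fun _ => ψ) A) m
  rw [hm, Nat.cast_zero, zero_add, mul_one] at h
  rw [← h, pderiv_outputState, Finset.filter_true_of_mem fun _ _ => rfl, coeff_sum]
  exact Finset.sum_congr rfl fun k _ => coeff_C_mul _ _ _

/-- All photons leave in the same mode. -/
theorem coeff_single_outputState (U : Matrix (Fin N) (Fin N) ℂ) (ψ : ι) (A : Finset (Fin N))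
    (j : Fin N) :
    coeff (Finsupp.single (j, ψ) A.card) (outputState U (fun _ => ψ) A) = ∏ k ∈ A, U j k := by
  classical
  induction A using Finset.induction_on with
  | empty => simp [outputState]
  | insert a A ha ih =>
    have h1 : outputState U (fun _ => ψ) (insert a A) =
        (∑ j, C (U j a) * X (j, ψ)) * outputState U (fun _ => ψ) A := Finset.prod_insert ha
    rw [h1, Finset.sum_mul, coeff_sum, Finset.sum_eq_single j]
    · rw [Finset.card_insert_of_notMem ha, Finset.prod_insert ha, mul_assoc, coeff_C_mul, add_comm,
        Finsupp.single_add, coeff_X_mul, ih]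
    · intro j' _ hj'
      rw [mul_assoc, coeff_C_mul, coeff_X_mul', if_neg, mul_zero]
      intro h
      have h2 := Finset.mem_singleton.1 (Finsupp.support_single_subset h)
      exact hj' (congrArg Prod.fst h2)
    · simp

theorem fin_one_add_one_ne_zero (M : ℕ) : (1 : Fin (M + 3)) + 1 ≠ 0 := by
  intro h
  have h' : 2 % (M + 3) = 0 := by simpa [Fin.val_add] using congrArg Fin.val h
  rw [Nat.mod_eq_of_lt (by omega)] at h'
  omega

/-- One photon in each neighbour of mode `b`, all others in mode `b`.  Relative to the product
of the entries of row `b`, the alternative with photon `k` above and photon `l` below contributes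
`ω ^ k * ω ^ (-l)`, and the sum over `k ≠ l` is `(∑ ω ^ k) * (∑ ω ^ (-l)) - N = -N`. -/
theorem coeff_outputState_fourier_neighbours (hN : 3 ≤ N) [NeZero N] (ψ : ι) (b : Fin N) :
    coeff (Finsupp.single (b, ψ) (N - 2) + Finsupp.single (b - 1, ψ) 1 +
      Finsupp.single (b + 1, ψ) 1) (outputState (fourierMatrix N) (fun _ => ψ) Finset.univ) =
      (∏ k, fourierMatrix N b k) * -N := by
  classical
  obtain ⟨M, rfl⟩ : ∃ M, N = M + 3 := ⟨N - 3, by omega⟩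
  set F := fourierMatrix (M + 3)
  set ω := fourierRoot (M + 3)
  have hω : IsPrimitiveRoot ω (M + 3) := isPrimitiveRoot_fourierRoot
  have hω0 : ω ≠ 0 := fourierRoot_ne_zero
  have h2 : (1 : Fin (M + 3)) + 1 ≠ 0 := fin_one_add_one_ne_zero M
  have hb1 : b - 1 ≠ b := by simp
  have hb2 : b + 1 ≠ b := by simp
  have hb3 : b - 1 ≠ b + 1 := by
    intro h
    rw [sub_eq_iff_eq_add, add_assoc] at h
    exact h2 (by simpa using h)
  have hrow : ∀ j k : Fin (M + 3), F (j + 1) k = ω ^ (k : ℕ) * F j k := fun j k => by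
    have h := fourierMatrix_add k j 1
    have hv : ((1 : Fin (M + 3)) : ℕ) = 1 := rfl
    rw [fourierMatrix_symm k, fourierMatrix_symm k, hv, pow_one] at h
    exact h
  have hup : ∀ k, F (b + 1) k = ω ^ (k : ℕ) * F b k := hrow b
  have hdown : ∀ k, F (b - 1) k = (ω⁻¹) ^ (k : ℕ) * F b k := fun k => by
    have h := hrow (b - 1) k
    rw [sub_add_cancel] at h
    rw [h, ← mul_assoc, ← mul_pow, inv_mul_cancel₀ hω0, one_pow, one_mul]
  rw [coeff_add_single_outputState _ _ _ _ (by simp [hb3, hb2])]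
  have hterm : ∀ k : Fin (M + 3), F (b + 1) k *
      coeff (Finsupp.single (b, ψ) (M + 3 - 2) + Finsupp.single (b - 1, ψ) 1)
        (outputState F (fun _ => ψ) (Finset.univ.erase k)) =
      (∏ k, F b k) * (ω ^ (k : ℕ) * ∑ l ∈ Finset.univ.erase k, (ω⁻¹) ^ (l : ℕ)) := fun k => by
    rw [coeff_add_single_outputState _ _ _ _ (by simp [hb1]), Finset.mul_sum,
      Finset.mul_sum, Finset.mul_sum]
    refine Finset.sum_congr rfl fun l hl => ?_
    have hcard : ((Finset.univ.erase k).erase l).card = M + 3 - 2 := by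
      rw [Finset.card_erase_of_mem hl, Finset.card_erase_of_mem (Finset.mem_univ k)]
      simp
    rw [← hcard, coeff_single_outputState, hup, hdown,
      ← Finset.mul_prod_erase _ _ (Finset.mem_univ k), ← Finset.mul_prod_erase _ _ hl]
    ring
  rw [Finset.sum_congr rfl fun k _ => hterm k, ← Finset.mul_sum]
  congr 1
  have hsum : ∀ z : ℂ, IsPrimitiveRoot z (M + 3) → ∑ k : Fin (M + 3), z ^ (k : ℕ) = 0 :=
    fun z hz => by
      rw [Fin.sum_univ_eq_sum_range]
      exact hz.geom_sum_eq_zero (by omega)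
  have herase : ∀ k : Fin (M + 3),
      ω ^ (k : ℕ) * ∑ l ∈ Finset.univ.erase k, (ω⁻¹) ^ (l : ℕ) = -1 := fun k => by
    rw [Finset.sum_erase_eq_sub (Finset.mem_univ k), hsum _ hω.inv, zero_sub, mul_neg, ← mul_pow,
      mul_inv_cancel₀ hω0, one_pow]
  rw [Finset.sum_congr rfl fun k _ => herase k]
  simp

theorem exists_idealHeraldProb_fourier_pos (src : OrthogonalBadBits N ι) (o : Fin N)
    (hN : N ≠ 2) :
    ∃ s : Pattern o, s.LeavesOne ∧ 0 < idealHeraldProb src (fourierMatrix N) {s} := by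
  classical
  have : NeZero N := ⟨o.pos.ne'⟩
  -- It suffices to find a configuration of nonzero amplitude with one photon in mode `o`.
  suffices h : ∃ n : Fin N × ι →₀ ℕ, photonCount n o = 1 ∧
      coeff n (outputState (fourierMatrix N) (fun _ => src.ψ) Finset.univ) ≠ 0 by
    obtain ⟨n, h1, hc⟩ := h
    refine ⟨fun j => photonCount n j, ?_, ?_⟩
    · have hdeg := degree_of_mem_support_outputState (mem_support_iff.2 hc)
      rw [← sum_photonCount, Fintype.sum_eq_add_sum_subtype_ne _ o, h1, Finset.card_univ,
        Fintype.card_fin, add_comm] at hdeg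
      exact hdeg
    · rw [idealHeraldProb, linearOptics_inputState]
      exact eventProb_pos_iff.2 ⟨n, rfl, hc⟩
  have hF : ∀ b : Fin N, ∏ k, fourierMatrix N b k ≠ 0 := fun b =>
    Finset.prod_ne_zero_iff.2 fun k _ => fourierMatrix_ne_zero b k
  rcases Nat.lt_or_ge N 3 with h | h
  · have hN1 : N = 1 := by have := o.pos; omega
    refine ⟨Finsupp.single (o, src.ψ) (Finset.univ : Finset (Fin N)).card, ?_, ?_⟩
    · simp [photonCount_single, hN1]
    · rw [coeff_single_outputState]
      exact hF o
  · have hc := coeff_outputState_fourier_neighbours h src.ψ (o - 1)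
    rw [sub_add_cancel] at hc
    refine ⟨_, ?_, hc ▸ mul_ne_zero (hF _) (neg_ne_zero.2 (Nat.cast_ne_zero.2 (NeZero.ne N)))⟩
    obtain ⟨M, rfl⟩ : ∃ M, N = M + 3 := ⟨N - 3, by omega⟩
    have h2 : (1 : Fin (M + 3)) + 1 ≠ 0 := fin_one_add_one_ne_zero M
    have hb1 : o - 1 ≠ o := by simp
    have hb2 : o - 1 - 1 ≠ o := by
      intro h
      rw [sub_sub, sub_eq_iff_eq_add] at h
      exact h2 (by simpa using h)
    simp [photonCount_add, photonCount_single, hb1, hb2]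

end FourierInterference

end PhotonDistillation

open PhotonDistillation in
theorem theorem1 {N : ℕ} {ι : Type*} (src : OrthogonalBadBits N ι) (o : Fin N) :
    -- the lower bound, for every unitary and every choice of heralding patterns
    (∃ C : ℝ, ∀ U ∈ Matrix.unitaryGroup (Fin N) ℂ, ∀ S : Set (Pattern o),
      (∀ s ∈ S, s.LeavesOne) → ∀ ε ∈ Set.Icc (0 : ℝ) 1, 0 < heraldProb src U S ε →
        distilledError src U S ε ≥ ε / N - C * ε ^ 2) ∧
    -- the Fourier transform attains it
    fourierMatrix N ∈ Matrix.unitaryGroup (Fin N) ℂ ∧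
    (∀ S : Set (Pattern o), S.Nonempty →
      (∀ s ∈ S, s.LeavesOne ∧ 0 < idealHeraldProb src (fourierMatrix N) {s}) →
        ∃ C : ℝ, ∀ ε ∈ Set.Ico (0 : ℝ) 1,
          0 < heraldProb src (fourierMatrix N) S ε ∧
            |distilledError src (fourierMatrix N) S ε - ε / N| ≤ C * ε ^ 2) ∧
    -- and its scheme is not void
    (N ≠ 2 → ∃ s : Pattern o, s.LeavesOne ∧ 0 < idealHeraldProb src (fourierMatrix N) {s}) := by
  have : NeZero N := ⟨o.pos.ne'⟩
  refine ⟨⟨0, fun U _ S hS ε hε h => ?_⟩, fourierMatrix_mem_unitaryGroup, fun S hne hS => ?_,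
    exists_idealHeraldProb_fourier_pos src o⟩
  · simpa using div_le_distilledError src U hS hε h
  · obtain ⟨s, hs⟩ := hne
    refine exists_abs_distilledError_sub_le src _ (fun s hs => (hS s hs).1) ?_
      (idealHeraldProb_fourier src hS)
    refine (hS s hs).2.trans_le (eventProb_mono fun n _ hn => ?_)
    have hn' : (fun j : {j : Fin N // j ≠ o} => photonCount n j) = s := hn
    rw [heraldEvent, Set.mem_ofPred_eq, hn']
    exact hs
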